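/- Let $S$ be a monoid. A (left) $S$-act is a set with a left action of $S$; an embedding of acts is an injective $S$-equivariant map; a subact is a subset closed under the action, written $A\le B$. Write $(S\text{-acts},\le)$ for the class of all left $S$-acts ordered by the subact relation. Let $\|A\|$ be the cardinality of $A$. For acts $N\le M$ with $\|M\|=\|N\|=\lambda$, $M$ is *universal over* $N$ if for every act $N^*\ge N$ with $\|N^*\|=\lambda$ there is an embedding $N^*\to M$ fixing $N$ pointwise. For an infinite cardinal $\lambda$, an act $M$ is a *$\lambda$-limit model* if for some limit ordinal $\alpha<\lambda^+$ there is an increasing chain $(M_i)_{i<\alpha}$ of acts of cardinality $\lambda$ (each a subact of the later ones) with $M_i=\bigcup_{j<i}M_j$ for limit $i<\alpha$, with $M_{i+1}$ universal over $M_i$ for all $i<\alpha$, and with $M=\bigcup_{i<\alpha}M_i$. The class $(S\text{-acts},\le)$ is *superstable* if there is a cardinal $\mu\ge\operatorname{card}(S)+\aleph_0$ such that for every $\lambda\ge\mu$ there is a $\lambda$-limit model and any two $\lambda$-limit models are isomorphic. Then $(S\text{-acts},\le)$ is superstable in each of the following cases: 1. $S$ is a finite monoid; 2. $S$ is a group;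 3. $S$ is a finitely generated commutative monoid. -/

import Mathlib

universe u

open Cardinal Ordinal

/-! Left `S`-acts are types with a `MulAction S`, homomorphisms are the equivariant maps `A →[S] B`,
embeddings are the injective ones, and subacts are `SubMulAction`s. The abstract elementary class
considered is that of all left `S`-acts (in the universe of `S`), ordered by "is a subact of". -/

namespace Act

variable (S : Type u) [Monoid S]

/-- The Löwenheim-Skolem number `card(S) + ℵ₀` of the class of `S`-acts with embeddings. -/
noncomputable def lsNumber : Cardinal.{u} := #S + ℵ₀

variable {S}

/-- For subacts `N`, `P` of an act `X`: `P` is universal over `N`, that is, `N ≤ P`, the acts `N` and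
`P` have the same cardinality, and every extension `B` of `N` of that cardinality (given by an
embedding `j : N → B`) embeds into `P` over `N`. -/
def IsUniversalOver {X : Type u} [MulAction S X] (P N : SubMulAction S X) : Prop :=
  N ≤ P ∧ #P = #N ∧
    ∀ (B : Type u) [MulAction S B] (j : N →[S] B), Function.Injective j → #B = #N →
      ∃ f : B →[S] P, Function.Injective f ∧ ∀ a : N, (f (j a) : X) = (a : X)

/-- The act `M` is a `(κ, α)`-limit model over its subact `N`. Only the values `C i` with `i < α`
of the chain matter. -/
def IsLimitModelOver {M : Type u} [MulAction S M] (κ : Cardinal.{u}) (α : Ordinal.{u})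
    (N : SubMulAction S M) : Prop :=
  ℵ₀ ≤ κ ∧ Order.IsSuccLimit α ∧ α < (Order.succ κ).ord ∧
    ∃ C : Ordinal.{u} → SubMulAction S M,
      (∀ i < α, #(C i) = κ) ∧
      (∀ i j, i ≤ j → j < α → C i ≤ C j) ∧
      (∀ i < α, Order.IsSuccLimit i → (C i : Set M) = ⋃ j ∈ Set.Iio i, (C j : Set M)) ∧
      C 0 = N ∧
      (Set.univ : Set M) = ⋃ i ∈ Set.Iio α, (C i : Set M) ∧
      ∀ i < α, IsUniversalOver (C (Order.succ i)) (C i)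

variable (S)

/-- `M` is a `κ`-limit model: it is a `(κ, α)`-limit model over some `N`, for some limit ordinal
`α < κ⁺`. -/
def IsLimitModel (κ : Cardinal.{u}) (M : Type u) [MulAction S M] : Prop :=
  ∃ (α : Ordinal.{u}) (N : SubMulAction S M), IsLimitModelOver κ α N

/-- There is a `κ`-limit model, and any two `κ`-limit models are isomorphic. -/
def HasUniqueLimitModel (κ : Cardinal.{u}) : Prop :=
  (∃ (M : Type u) (_ : MulAction S M), IsLimitModel S κ M) ∧
    ∀ (M M' : Type u) [MulAction S M] [MulAction S M'],
      IsLimitModel S κ M → IsLimitModel S κ M' →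
        ∃ f : M →[S] M', Function.Bijective f

/-- The class of `S`-acts with embeddings is superstable: on a tail of cardinals `κ` there is exactly
one `κ`-limit model up to isomorphism. -/
def Superstable : Prop :=
  ∃ μ : Cardinal.{u}, lsNumber S ≤ μ ∧ ∀ κ : Cardinal.{u}, μ ≤ κ → HasUniqueLimitModel S κ

end Act

/-! In all three cases `S` satisfies the ascending chain condition on left ideals (`SubMulAction S
S`), and that alone gives superstability, with threshold `2 ^ lsNumber S`.

Existence: inside a cofree act, take the functions on `S` that use finitely many colors from `ℕ ×
L`. Bounding the `ℕ`-coordinate by `n` filters this act by a chain of length `ω`, and level `n + 1`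
is universal over level `n` (`isUniversalOver_coloredLE`). The chain condition is what makes
finitely many colors enough.

Uniqueness: a back-and-forth of length `κ` through partial isomorphisms of size `< κ`. To add `a` to
the domain `D`, note that `{s | s • a ∈ D}` is a finitely generated left ideal, so the images of the
elements `s • a ∈ D` lie in one member of the chain, whatever the length of the chain. Universality
of the next member over it yields a partner for `a` (`IsLimitModel.exists_sup_cyclic`). -/

namespace Act

/-! ### Finiteness consequences of the chain condition on left ideals. -/

section Noetherian

variable {S : Type u} [Monoid S]

/-- The subact generated by one element. -/
def cyclic {X : Type*} [MulAction S X] (x : X) : SubMulAction S X where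
  carrier := MulAction.orbit S x
  smul_mem' s _ h := MulAction.mem_orbit_of_mem_orbit s h

theorem mem_cyclic {X : Type*} [MulAction S X] {x y : X} :
    y ∈ cyclic (S := S) x ↔ ∃ s : S, s • x = y := Iff.rfl

theorem exists_finset_generators [WellFoundedGT (SubMulAction S S)] (I : SubMulAction S S) :
    ∃ F : Finset S, (∀ t ∈ F, t ∈ I) ∧ ∀ s ∈ I, ∃ t ∈ F, ∃ r : S, r * t = s := by
  classical
  obtain ⟨T, hT, hsup⟩ := CompleteLattice.WellFoundedGT.isSupFiniteCompact (SubMulAction S S)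
    (cyclic (S := S) '' (I : Set S))
  obtain ⟨F, hF, rfl⟩ := Finset.subset_set_image_iff.1 hT
  refine ⟨F, fun t ht => hF ht, fun s hs => ?_⟩
  have h1 : s ∈ sSup (cyclic (S := S) '' (I : Set S)) :=
    (le_sSup (Set.mem_image_of_mem (cyclic (S := S)) hs) : cyclic s ≤ _)
      (MulAction.mem_orbit_self s)
  rw [hsup, Finset.sup_image, Finset.sup_eq_iSup] at h1
  simp only [SubMulAction.mem_iSup, Function.comp, id, mem_cyclic, _root_.smul_eq_mul] at h1
  obtain ⟨t, ht, r, hr⟩ := h1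
  exact ⟨t, ht, r, hr⟩

/-- Sublevel sets of `c` are left ideals, strictly increasing along the values of `c`. So the range
is well-founded in both directions, and a linear order of that kind is finite. -/
theorem finite_range_of_smul_le [WellFoundedGT (SubMulAction S S)] {X : Type*} [LinearOrder X]
    [WellFoundedLT X] (c : S → X) (hc : ∀ r s, c (r * s) ≤ c s) : (Set.range c).Finite := by
  let I : Set.range c → SubMulAction S S := fun x =>
    { carrier := {s | c s ≤ x}
      smul_mem' := fun r s hs => (hc r s).trans hs }
  have hI : StrictMono I := by
    intro x y hxy
    refine lt_of_le_not_ge (fun s (hs : c s ≤ x) => hs.trans hxy.le) fun h => ?_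
    obtain ⟨s, hs⟩ := y.2
    have h1 : c s ≤ x := h (show c s ≤ y from hs.le)
    exact absurd hxy (not_lt.2 (show (y : X) ≤ x from hs ▸ h1))
  have := hI.wellFoundedGT
  exact Set.finite_coe_iff.1 (Finite.of_wellFoundedLT_wellFoundedGT (Set.range c))

end Noetherian

/-! ### The chain condition in the three cases. -/

theorem wellFoundedGT_of_finite (S : Type u) [Monoid S] [Finite S] :
    WellFoundedGT (SubMulAction S S) :=
  have : Finite (SubMulAction S S) := Finite.of_injective _ SetLike.coe_injective
  inferInstance

theorem wellFoundedGT_of_group (S : Type u) [Group S] : WellFoundedGT (SubMulAction S S) := by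
  have : Function.Injective fun I : SubMulAction S S => (1 : S) ∈ I := by
    have h (I : SubMulAction S S) (s : S) : s ∈ I ↔ (1 : S) ∈ I :=
      ⟨fun hs => by simpa using I.smul_mem s⁻¹ hs, fun h1 => by simpa using I.smul_mem s h1⟩
    intro I J hIJ
    ext s
    rw [h I, h J]
    exact iff_of_eq hIJ
  have := Finite.of_injective _ this
  infer_instance

/-- The ideal of the monoid algebra spanned by an ideal of a commutative monoid. -/
noncomputable def monoidAlgebraIdeal {S : Type u} [CommMonoid S] (I : SubMulAction S S) :
    Ideal (MonoidAlgebra ℤ S) :=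
  Ideal.span (MonoidAlgebra.of ℤ S '' (I : Set S))

/-- An ideal spanned by monomials contains only those monomials that are multiples of the spanning
ones, so `I` can be recovered from its span. -/
theorem of_mem_monoidAlgebraIdeal {S : Type u} [CommMonoid S] {I : SubMulAction S S} {s : S} :
    MonoidAlgebra.of ℤ S s ∈ monoidAlgebraIdeal I ↔ s ∈ I := by
  refine ⟨fun h => ?_, fun h => Ideal.subset_span (Set.mem_image_of_mem _ h)⟩
  rw [monoidAlgebraIdeal, MonoidAlgebra.mem_ideal_span_of_image] at h
  obtain ⟨t, ht, d, hd⟩ := h s (by simp [MonoidAlgebra.of])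
  rw [hd]
  exact I.smul_mem d ht

/-- Hilbert's basis theorem makes `ℤ[S]` noetherian, and the ideals of `S` embed strictly
monotonically into its ideals. -/
theorem wellFoundedGT_of_commMonoid_fg (S : Type u) [CommMonoid S] [Monoid.FG S] :
    WellFoundedGT (SubMulAction S S) := by
  have : IsNoetherianRing (MonoidAlgebra ℤ S) := Algebra.FiniteType.isNoetherianRing ℤ _
  have hmono : StrictMono (monoidAlgebraIdeal (S := S)) := by
    refine Monotone.strictMono_of_injective
      (fun I J h => Ideal.span_mono (Set.image_mono h)) fun I J h => ?_
    ext s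
    rw [← of_mem_monoidAlgebraIdeal, h, of_mem_monoidAlgebraIdeal]
  exact hmono.wellFoundedGT

/-- The cofree `S`-act on `X`. -/
def Cofree (S X : Type u) : Type u := S → X

namespace Cofree

variable {S : Type u} [Monoid S] {X : Type u}

instance : MulAction S (Cofree S X) where
  smul s φ := fun t => φ (t * s)
  one_smul φ := funext fun t => congrArg φ (mul_one t)
  mul_smul r s φ := funext fun t => congrArg φ (mul_assoc t r s).symm

/-- The equivariant map to a cofree act induced by a map. -/
def lift {A : Type*} [MulAction S A] (h : A → X) : A →[S] Cofree S X where
  toFun a := fun s => h (s • a)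
  map_smul' r a := funext fun s => congrArg h (mul_smul s r a).symm

theorem lift_apply {A : Type*} [MulAction S A] (h : A → X) (a : A) (s : S) :
    lift h a s = h (s • a) := rfl

end Cofree

/-! ### Existence: colored functions in a cofree act. -/

section Existence

theorem mk_fun_le {S T : Type u} (hT : #T ≤ lsNumber S) : #(S → T) ≤ 2 ^ lsNumber S := by
  have h : ℵ₀ ≤ lsNumber S := self_le_add_left _ _
  rw [← power_self_eq h, ← power_def]
  exact (power_le_power_right hT).trans
    (power_le_power_left (aleph0_pos.trans_le h).ne' (self_le_add_right _ _))

variable (S : Type u) [Monoid S] (L : Type u)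

/-- The functions `S → (ℕ × L) × S` that use only finitely many colors in `ℕ × L`. -/
def Colored : SubMulAction S (Cofree S ((ℕ × L) × S)) where
  carrier := {φ | (Set.range fun s => (φ s).1).Finite}
  smul_mem' r φ hφ := hφ.subset (by
    rintro _ ⟨s, rfl⟩
    exact ⟨s * r, rfl⟩)

/-- The elements of `Colored S L` whose colors have first coordinate at most `i`. -/
def coloredLE (i : Ordinal.{u}) : SubMulAction S (Colored S L) where
  carrier := {φ | ∀ s, (((φ.1 s).1.1 : ℕ) : Ordinal.{u}) ≤ i}
  smul_mem' r _ hφ s := hφ (s * r)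

variable {S L}

theorem mk_colored_le (hL : 2 ^ lsNumber S ≤ #L) : #(Colored S L) ≤ #L := by
  classical
  have hS : ℵ₀ ≤ lsNumber S := self_le_add_left _ _
  have hL0 : ℵ₀ ≤ #L := hS.trans ((cantor _).le.trans hL)
  have : Infinite L := infinite_iff.2 hL0
  have hfin (φ : Colored S L) : ∃ l : List (ℕ × L), ∀ s, (φ.1 s).1 ∈ l :=
    ⟨φ.2.toFinset.toList, fun s => Finset.mem_toList.2 (φ.2.mem_toFinset.2 ⟨s, rfl⟩)⟩
  choose l hl using hfin
  -- A colored function is encoded by a list of its colors, the position in the list of the color at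
  -- each `s`, and its `S`-component. There are at most `#L` lists and at most `2 ^ lsNumber S`
  -- choices for each of the other two.
  have hinj : Function.Injective fun φ : Colored S L =>
      (l φ, (fun s => ULift.up ((l φ).idxOf (φ.1 s).1) : S → ULift.{u} ℕ),
        (fun s => (φ.1 s).2 : S → S)) := by
    intro φ ψ h
    simp only [Prod.mk.injEq] at h
    obtain ⟨h1, h2, h3⟩ := h
    refine Subtype.ext (funext fun s => Prod.ext ?_ (congrFun h3 s))
    have h4 := congrArg ULift.down (congrFun h2 s)
    simp only [h1] at h4
    exact (List.idxOf_inj (h1 ▸ hl φ s)).1 h4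
  refine (mk_le_of_injective hinj).trans ?_
  simp only [mk_prod, Cardinal.lift_id]
  refine mul_le_of_le hL0 ?_ (mul_le_of_le hL0 ((mk_fun_le ?_).trans hL)
    ((mk_fun_le (self_le_add_right _ _)).trans hL))
  · rw [mk_list_eq_mk, mk_prod]
    simp
  · simpa using hS

theorem mk_coloredLE (hL : 2 ^ lsNumber S ≤ #L) (i : Ordinal.{u}) : #(coloredLE S L i) = #L := by
  refine le_antisymm ((mk_subtype_le _).trans (mk_colored_le hL)) ?_
  refine mk_le_of_injective (f := fun x => (⟨⟨fun _ => ((0, x), 1), ?_⟩, ?_⟩ : coloredLE S L i)) ?_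
  · exact (Set.finite_singleton (0, x)).subset (by rintro _ ⟨s, rfl⟩; rfl)
  · intro s
    simp
  · intro x y h
    have h1 := congrFun (congrArg (fun φ : coloredLE S L i => φ.1.1) h) 1
    simpa using h1

/-- Every act is a union of pairwise disjoint classes, each of them covered by a cyclic subact, such
that every cyclic subact meets only finitely many classes. -/
theorem exists_coloring [WellFoundedGT (SubMulAction S S)] (B : Type u) [MulAction S B] :
    ∃ (c : B → B) (l : B → S), (∀ b, l b • c b = b) ∧
      ∀ b, (Set.range fun s : S => c (s • b)).Finite := by
  obtain ⟨_, _⟩ := exists_wellFoundedLT B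
  -- The class of `b` is named by the least `x` generating `b`. Any generator of `b` also generates
  -- `r • b`, so this name can only decrease under the action.
  have h (b : B) : ∃ x, ∃ s : S, s • x = b ∧ ∀ y, b ∈ cyclic (S := S) y → x ≤ y := by
    obtain ⟨x, ⟨s, hs⟩, hx⟩ := wellFounded_lt.has_min {x | b ∈ cyclic (S := S) x}
      ⟨b, MulAction.mem_orbit_self b⟩
    exact ⟨x, s, hs, fun y hy => not_lt.1 (hx y hy)⟩
  choose c l hl hc using h
  refine ⟨c, l, hl, fun b => finite_range_of_smul_le _ fun r s => hc _ _ ⟨r * l (s • b), ?_⟩⟩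
  simp only [mul_smul, hl]

theorem isUniversalOver_coloredLE [WellFoundedGT (SubMulAction S S)] (hL : 2 ^ lsNumber S ≤ #L)
    (n : ℕ) :
    IsUniversalOver (coloredLE S L (Order.succ (n : Ordinal.{u}))) (coloredLE S L n) := by
  classical
  refine ⟨fun φ hφ s => (hφ s).trans (Order.le_succ _), by simp only [mk_coloredLE hL],
    fun B _ j hj hB => ?_⟩
  obtain ⟨e⟩ := Cardinal.eq.1 (hB.trans (mk_coloredLE hL n))
  obtain ⟨c, l, hl, hc⟩ := exists_coloring (S := S) B
  -- The embedding will be `Cofree.lift h`. Evaluation at `1` on the image of `j` forces it to fix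
  -- `N`. Elements outside get the fresh level `n + 1`, which separates them from `N`, and the pair
  -- `(c b, l b)`, which determines `b = l b • c b`.
  have hh : ∃ h : B → (ℕ × L) × S, (∀ x, h (j x) = x.1.1 1) ∧
      ∀ b, (¬ ∃ x, j x = b) → h b = ((n + 1, e (c b)), l b) := by
    refine ⟨fun b => if hb : ∃ x, j x = b then hb.choose.1.1 1 else ((n + 1, e (c b)), l b),
      fun x => ?_, fun b hb => dif_neg hb⟩
    have hx : ∃ y, j y = j x := ⟨x, rfl⟩
    exact (dif_pos hx).trans (congrArg (fun y : coloredLE S L n => y.1.1 1) (hj hx.choose_spec))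
  obtain ⟨h, hhj, hhn⟩ := hh
  have hsmul (s : S) (x) : h (s • j x) = x.1.1 s := by
    rw [← map_smul, hhj]
    exact congrArg x.1.1 (one_mul s)
  have hfin (b : B) : Cofree.lift h b ∈ Colored S L := by
    -- On the left ideal of those `s` that send `b` into `N`, each of finitely many generators
    -- contributes the finitely many colors of one element of `N`. Off it, the colors come from the
    -- finitely many classes met by the orbit of `b`.
    let I : SubMulAction S S :=
      { carrier := {s | ∃ x, j x = s • b}
        smul_mem' := fun r s ⟨x, hx⟩ => ⟨r • x, by
          rw [map_smul, hx, smul_smul, _root_.smul_eq_mul]⟩ }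
    obtain ⟨F, hF, hFI⟩ := exists_finset_generators I
    have hT (t : S) : ∃ T : Set (ℕ × L), T.Finite ∧ (t ∈ F → ∀ r : S, (h (r • t • b)).1 ∈ T) := by
      by_cases ht : t ∈ F
      · obtain ⟨x, hx⟩ := hF t ht
        refine ⟨_, x.1.2, fun _ r => ⟨r, ?_⟩⟩
        rw [← hx, hsmul]
      · exact ⟨∅, Set.finite_empty, fun h => (ht h).elim⟩
    choose T hT hmem using hT
    refine Set.Finite.subset (((hc b).image fun y => ((n + 1, e y) : ℕ × L)).union
      (F.finite_toSet.biUnion fun t _ => hT t)) ?_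
    rintro _ ⟨s, rfl⟩
    by_cases hs : ∃ y, j y = s • b
    · obtain ⟨t, ht, r, rfl⟩ := hFI s hs
      refine Or.inr (Set.mem_biUnion ht ?_)
      simp only [Cofree.lift_apply, mul_smul]
      exact hmem t ht r
    · refine Or.inl ⟨_, ⟨s, rfl⟩, ?_⟩
      simp only [Cofree.lift_apply, hhn _ hs]
  have hle (b : B) : (⟨_, hfin b⟩ : Colored S L) ∈ coloredLE S L (Order.succ (n : Ordinal.{u})) := by
    intro s
    simp only [Cofree.lift_apply]
    by_cases hs : ∃ y, j y = s • b
    · obtain ⟨y, hy⟩ := hs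
      rw [← hy, hhj]
      exact (y.2 1).trans (Order.le_succ _)
    · rw [hhn _ hs]
      simp
  refine ⟨⟨fun b => ⟨⟨_, hfin b⟩, hle b⟩, fun s b => ?_⟩, fun b b' hbb => ?_, fun x => ?_⟩
  · exact Subtype.ext (Subtype.ext (map_smul (Cofree.lift h) s b))
  · have h1 : Cofree.lift (S := S) h b = Cofree.lift h b' :=
      congrArg (fun φ : coloredLE S L _ => φ.1.1) hbb
    have h2 (s : S) : h (s • b) = h (s • b') := congrFun h1 s
    have key (x : coloredLE S L n) (b : B) (hb : ¬ ∃ y, j y = b) : h (j x) ≠ h b := by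
      intro h3
      rw [hhn b hb, hhj] at h3
      have h4 := x.2 1
      rw [h3, Nat.cast_le] at h4
      exact absurd h4 (Nat.not_succ_le_self n)
    have h3 := h2 1
    rw [one_smul, one_smul] at h3
    by_cases hb : ∃ y, j y = b
    · obtain ⟨y, rfl⟩ := hb
      by_cases hb' : ∃ y, j y = b'
      · obtain ⟨y', rfl⟩ := hb'
        congr 1
        refine Subtype.ext (Subtype.ext (funext fun s => ?_))
        rw [← hsmul, ← hsmul, h2]
      · exact (key y b' hb' h3).elim
    · by_cases hb' : ∃ y, j y = b'
      · obtain ⟨y', rfl⟩ := hb'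
        exact (key y' b hb h3.symm).elim
      · rw [hhn b hb, hhn b' hb'] at h3
        simp only [Prod.mk.injEq, true_and, e.apply_eq_iff_eq] at h3
        rw [← hl b, ← hl b', h3.1, h3.2]
  · exact Subtype.ext (funext fun s => hsmul s x)

/-- Finitely many colors have bounded `ℕ`-coordinate, so the levels `n < ω` exhaust `Colored S L`.
Continuity of the chain is vacuous below `ω`. -/
theorem isLimitModel_colored [WellFoundedGT (SubMulAction S S)] (hL : 2 ^ lsNumber S ≤ #L) :
    IsLimitModel S #L (Colored S L) := by
  have hS : ℵ₀ ≤ lsNumber S := self_le_add_left _ _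
  have hL0 : ℵ₀ ≤ #L := hS.trans ((cantor _).le.trans hL)
  refine ⟨ω, coloredLE S L 0, hL0, isSuccLimit_omega0, ?_, coloredLE S L,
    fun i _ => mk_coloredLE hL i, fun i j hij _ φ hφ s => (hφ s).trans hij, ?_, rfl, ?_, ?_⟩
  · rw [lt_ord, card_omega0, Order.lt_succ_iff]
    exact hL0
  · intro i hi hlim
    exact absurd hi (not_lt.2 (omega0_le_of_isSuccLimit hlim))
  · refine (Set.eq_univ_of_forall fun φ => ?_).symm
    obtain ⟨n, hn⟩ := (φ.2.image Prod.fst).bddAbove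
    refine Set.mem_biUnion (x := (n : Ordinal.{u})) (natCast_lt_omega0 n) fun s => ?_
    exact Nat.cast_le.2 (hn ⟨_, ⟨s, rfl⟩, rfl⟩)
  · intro i hi
    obtain ⟨n, rfl⟩ := lt_omega0.1 hi
    exact isUniversalOver_coloredLE hL n

end Existence

/-! ### Uniqueness: back-and-forth between limit models. -/

section BackAndForth

variable {S : Type u} [Monoid S] {A M : Type u} [MulAction S A] [MulAction S M]

/-- A subact of `A × M` is a partial isomorphism if it is the graph of an injective map defined on
a subset of `A`. -/
def IsPartialIso (G : SubMulAction S (A × M)) : Prop :=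
  ∀ p ∈ G, ∀ q ∈ G, p.1 = q.1 ↔ p.2 = q.2

/-- Abstract back-and-forth: `R` is the list of requirements and `D r x` says that `x` meets `r`.
Transfinite recursion along a well-order of `R` of least type adds one cyclic subact per step.
Proper initial segments have fewer than `κ` elements and `lsNumber S < κ`, so every stage stays
below `κ`. -/
theorem exists_extension_meeting {X : Type u} [MulAction S X] {R : Type u}
    (Good : SubMulAction S X → Prop) (D : R → X → Prop) {κ : Cardinal.{u}} (hκ : lsNumber S < κ)
    (hR : #R ≤ κ)
    (hchain : ∀ (ι : Type u) [LinearOrder ι] (G : ι → SubMulAction S X), Monotone G →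
      (∀ i, Good (G i)) → Good (⨆ i, G i))
    (hext : ∀ G, Good G → #G < κ → ∀ r, ∃ x, D r x ∧ Good (G ⊔ cyclic x)) :
    ∃ G, Good G ∧ ∀ r, ∃ x ∈ G, D r x := by
  classical
  have hS : ℵ₀ ≤ lsNumber S := self_le_add_left _ _
  obtain ⟨_, _, hord⟩ := exists_ord_eq_type_lt R
  -- The one-step extension is made total, with default `G' = G`, so that the recursion can be
  -- defined before goodness and size are known.
  have hE (G : SubMulAction S X) (r : R) : ∃ G', G ≤ G' ∧ #G' ≤ #G + #S ∧
      (Good G → #G < κ → Good G' ∧ ∃ x ∈ G', D r x) := by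
    by_cases h : Good G ∧ #G < κ
    · obtain ⟨x, hx, hG⟩ := hext G h.1 h.2 r
      refine ⟨G ⊔ cyclic x, le_sup_left, ?_, fun _ _ =>
        ⟨hG, x, Or.inr (MulAction.mem_orbit_self x), hx⟩⟩
      exact (mk_union_le (G : Set X) (MulAction.orbit S x)).trans
        (add_le_add_right mk_range_le _)
    · exact ⟨G, le_rfl, self_le_add_right _ _, fun h1 h2 => (h ⟨h1, h2⟩).elim⟩
  choose E hle hcard hgood using hE
  let G : R → SubMulAction S X := wellFounded_lt.fix fun i IH => E (⨆ j : Set.Iio i, IH j j.2) i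
  have hG (i : R) : G i = E (⨆ j : Set.Iio i, G j) i := wellFounded_lt.fix_eq _ i
  have hlt {i j : R} (hij : i < j) : G i ≤ G j := by
    rw [hG j]
    exact (le_iSup (fun k : Set.Iio j => G k) ⟨i, hij⟩).trans (hle _ _)
  have hmono : Monotone G := fun i j hij => hij.lt_or_eq.elim hlt fun h => h ▸ le_rfl
  have hU (i : R) (IH : ∀ j < i, #(G j) ≤ lsNumber S + #(Set.Iio j)) :
      #(⨆ j : Set.Iio i, G j : SubMulAction S X) ≤ lsNumber S + #(Set.Iio i) := by
    have hinf : ℵ₀ ≤ lsNumber S + #(Set.Iio i) := hS.trans (self_le_add_right _ _)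
    have h1 : ((⨆ j : Set.Iio i, G j : SubMulAction S X) : Set X) = ⋃ j : Set.Iio i, (G j : Set X) := by
      ext x
      simp
    calc #(⨆ j : Set.Iio i, G j : SubMulAction S X)
        = #(⋃ j : Set.Iio i, (G j : Set X)) := congrArg (fun T : Set X => #T) h1
      _ ≤ #(Set.Iio i) * ⨆ j : Set.Iio i, #(G j : Set X) := mk_iUnion_le _
      _ ≤ (lsNumber S + #(Set.Iio i)) * (lsNumber S + #(Set.Iio i)) := by
        refine mul_le_mul' (self_le_add_left _ _) (ciSup_le' fun j => (IH j j.2).trans ?_)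
        exact add_le_add_right (mk_le_mk_of_subset (Set.Iio_subset_Iio j.2.le)) _
      _ = _ := mul_eq_self hinf
  have hc (i : R) : #(G i) ≤ lsNumber S + #(Set.Iio i) := by
    induction i using WellFoundedLT.induction with
    | ind i IH =>
      rw [hG]
      refine (hcard _ _).trans (add_le_of_le (hS.trans (self_le_add_right _ _)) (hU i IH) ?_)
      exact (self_le_add_right _ _).trans (self_le_add_right _ _)
  have hUκ (i : R) : #(⨆ j : Set.Iio i, G j : SubMulAction S X) < κ :=
    (hU i fun j _ => hc j).trans_lt
      (add_lt_of_lt (hS.trans hκ.le) hκ ((mk_Iio_lt i hord).trans_le hR))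
  have hgoodU (i : R) (IH : ∀ j < i, Good (G j)) : Good (⨆ j : Set.Iio i, G j) :=
    hchain _ _ (fun j k hjk => hmono hjk) fun j => IH j j.2
  have hgoodG (i : R) : Good (G i) := by
    induction i using WellFoundedLT.induction with
    | ind i IH =>
      rw [hG]
      exact (hgood _ i (hgoodU i IH) (hUκ i)).1
  refine ⟨⨆ i, G i, hchain _ _ hmono hgoodG, fun r => ?_⟩
  obtain ⟨x, hx, hD⟩ := (hgood _ r (hgoodU r fun j _ => hgoodG j) (hUκ r)).2
  rw [← hG] at hx
  exact ⟨x, SubMulAction.mem_iSup.2 ⟨r, hx⟩, hD⟩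

theorem IsPartialIso.iSup {ι : Type u} [LinearOrder ι] {G : ι → SubMulAction S (A × M)}
    (hmono : Monotone G) (hG : ∀ i, IsPartialIso (G i)) : IsPartialIso (⨆ i, G i) := by
  intro p hp q hq
  obtain ⟨i, hi⟩ := SubMulAction.mem_iSup.1 hp
  obtain ⟨k, hk⟩ := SubMulAction.mem_iSup.1 hq
  exact hG (max i k) p (hmono (le_max_left i k) hi) q (hmono (le_max_right i k) hk)

/-- `h1` makes `s • a ↦ s • p` well defined and injective, `h2` makes it agree with `G` on the
common domain, and `h3` forbids the orbit of `p` from meeting the range of `G` anywhere else. -/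
theorem IsPartialIso.sup_cyclic {G : SubMulAction S (A × M)} (hG : IsPartialIso G) {a : A} {p : M}
    (h1 : ∀ s t : S, s • a = t • a ↔ s • p = t • p)
    (h2 : ∀ (s : S) x, (s • a, x) ∈ G → s • p = x)
    (h3 : ∀ (s : S) x, (x, s • p) ∈ G → ∃ y, (s • a, y) ∈ G) :
    IsPartialIso (G ⊔ cyclic (a, p)) := by
  have key : ∀ x ∈ G, ∀ s : S, x.1 = s • a ↔ x.2 = s • p := by
    rintro ⟨x, y⟩ hx s
    dsimp only
    refine ⟨?_, ?_⟩
    · rintro rfl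
      exact (h2 s y hx).symm
    · rintro rfl
      obtain ⟨z, hz⟩ := h3 s x hx
      exact (hG _ hx _ hz).2 (h2 s z hz)
  rintro x (hx | ⟨s, rfl⟩) y (hy | ⟨t, rfl⟩)
  · exact hG x hx y hy
  · exact key x hx t
  · exact eq_comm.trans ((key y hy s).trans eq_comm)
  · exact h1 s t

/-- The image of a partial isomorphism under exchanging the factors. -/
def swap (G : SubMulAction S (A × M)) : SubMulAction S (M × A) where
  carrier := {x | x.swap ∈ G}
  smul_mem' s _ hx := G.smul_mem s hx

theorem IsPartialIso.swap {G : SubMulAction S (A × M)} (hG : IsPartialIso G) :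
    IsPartialIso (swap G) :=
  fun _ hp _ hq => (hG _ hp _ hq).symm

theorem mk_swap (G : SubMulAction S (A × M)) : #(swap G) = #G :=
  mk_congr ((Equiv.prodComm M A).subtypeEquiv fun _ => Iff.rfl)

theorem swap_sup_cyclic (G : SubMulAction S (A × M)) (a : A) (p : M) :
    swap (G ⊔ cyclic (a, p)) = swap G ⊔ cyclic (p, a) := by
  ext ⟨x, y⟩
  refine or_congr Iff.rfl ⟨?_, ?_⟩
  all_goals
    rintro ⟨s, hs⟩
    exact ⟨s, Prod.swap_injective hs⟩

/-- Extend `N` by `κ` copies of `a`, glued to `N` along `G` and otherwise disjoint, and embed the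
result into `P` over `N`. A copy can fail only by hitting the range of `G` outside the glued part.
Distinct copies hit it at distinct points, and `G` has fewer than `κ` of them. -/
theorem IsUniversalOver.exists_sup_cyclic {κ : Cardinal.{u}} (hS : lsNumber S ≤ κ)
    {P N : SubMulAction S M} (h : IsUniversalOver P N) (hN : #N = κ) {G : SubMulAction S (A × M)}
    (hG : IsPartialIso G) (hGκ : #G < κ) (a : A)
    (haN : ∀ (s : S) x, (s • a, x) ∈ G → x ∈ N) : ∃ p, IsPartialIso (G ⊔ cyclic (a, p)) := by
  classical
  have hκ : ℵ₀ ≤ κ := (self_le_add_left _ _).trans hS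
  -- The amalgam is realized inside a cofree act: `φ k` records, for each `s`, the partner of `s •
  -- a` in `N` if `s • a` is in the domain of `G`, and otherwise `s • a` tagged by `k`.
  let Y := Cofree S (N ⊕ κ.out × A)
  let i : N →[S] Y := Cofree.lift Sum.inl
  have hφ : ∃ φ : κ.out → Y, (∀ k s (x : N), (s • a, (x : M)) ∈ G → φ k s = Sum.inl x) ∧
      ∀ k s, (¬ ∃ x, (s • a, x) ∈ G) → φ k s = Sum.inr (k, s • a) := by
    refine ⟨fun k s => if hs : ∃ x, (s • a, x) ∈ G then Sum.inl ⟨hs.choose, haN s _ hs.choose_spec⟩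
      else Sum.inr (k, s • a), fun k s x hx => ?_, fun k s hs => dif_neg hs⟩
    have hs : ∃ x, (s • a, x) ∈ G := ⟨x, hx⟩
    exact (dif_pos hs).trans (congrArg Sum.inl (Subtype.ext ((hG _ hs.choose_spec _ hx).1 rfl)))
  obtain ⟨φ, hφG, hφn⟩ := hφ
  let B : SubMulAction S Y :=
    { carrier := Set.range i ∪ Set.range fun x : κ.out × S => x.2 • φ x.1
      smul_mem' := by
        rintro r _ (⟨x, rfl⟩ | ⟨⟨k, s⟩, rfl⟩)
        · exact Or.inl ⟨r • x, map_smul i r x⟩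
        · exact Or.inr ⟨(k, r * s), mul_smul r s (φ k)⟩ }
  let j : N →[S] B := ⟨fun x => ⟨i x, Or.inl ⟨x, rfl⟩⟩, fun s x => Subtype.ext (map_smul i s x)⟩
  have hj : Function.Injective j := by
    intro x y hxy
    have h1 : i x 1 = i y 1 := congrFun (congrArg Subtype.val hxy) 1
    rw [Cofree.lift_apply, Cofree.lift_apply, one_smul, one_smul] at h1
    exact Sum.inl_injective h1
  have hB : #B = #N := by
    refine le_antisymm ?_ (mk_le_of_injective hj)
    refine (mk_union_le _ _).trans ((add_le_add mk_range_le mk_range_le).trans ?_)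
    rw [hN, mk_prod, Cardinal.lift_id, Cardinal.lift_id, mk_out]
    exact add_le_of_le hκ le_rfl (mul_le_of_le hκ le_rfl ((self_le_add_right _ _).trans hS))
  obtain ⟨f, hf, hfj⟩ := h.2.2 B j hj hB
  let p (k : κ.out) : M := f ⟨φ k, Or.inr ⟨(k, 1), one_smul S _⟩⟩
  have hp (k l : κ.out) (s t : S) : s • p k = t • p l ↔ s • φ k = t • φ l := by
    have h1 : s • p k = t • p l ↔
        f (s • ⟨φ k, Or.inr ⟨(k, 1), one_smul S _⟩⟩) = f (t • ⟨φ l, Or.inr ⟨(l, 1), one_smul S _⟩⟩) := by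
      rw [map_smul, map_smul, Subtype.ext_iff]
      rfl
    rw [h1, hf.eq_iff, Subtype.ext_iff]
    rfl
  have happ (k : κ.out) (s : S) : (s • φ k) 1 = φ k s := congrArg (φ k) (one_mul s)
  have hpG (k : κ.out) (s : S) (x : M) (hx : (s • a, x) ∈ G) : s • p k = x := by
    have h1 : (s • ⟨φ k, Or.inr ⟨(k, 1), one_smul S _⟩⟩ : B) = j ⟨x, haN s x hx⟩ := by
      refine Subtype.ext (funext fun t => ?_)
      refine hφG k (t * s) (t • (⟨x, haN s x hx⟩ : N)) ?_
      rw [mul_smul]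
      exact G.smul_mem t hx
    have h2 := hfj ⟨x, haN s x hx⟩
    rw [← h1, map_smul] at h2
    exact h2
  have hpa (k : κ.out) (s t : S) : s • a = t • a ↔ s • p k = t • p k := by
    rw [hp]
    refine ⟨fun hst => funext fun r => ?_, fun hst => ?_⟩
    · have hrst : (r * s) • a = (r * t) • a := by rw [mul_smul, mul_smul, hst]
      change φ k (r * s) = φ k (r * t)
      by_cases hr : ∃ x, ((r * s) • a, x) ∈ G
      · obtain ⟨x, hx⟩ := hr
        rw [hφG k (r * s) ⟨x, haN _ _ hx⟩ hx, hφG k (r * t) ⟨x, haN _ _ hx⟩ (hrst ▸ hx)]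
      · rw [hφn k _ hr, hφn k _ (hrst ▸ hr), hrst]
    · have h1 := congrFun hst 1
      rw [happ, happ] at h1
      by_cases hs : ∃ x, (s • a, x) ∈ G
      · obtain ⟨x, hx⟩ := hs
        by_cases ht : ∃ x, (t • a, x) ∈ G
        · obtain ⟨y, hy⟩ := ht
          rw [hφG k s ⟨x, haN _ _ hx⟩ hx, hφG k t ⟨y, haN _ _ hy⟩ hy] at h1
          exact (hG _ hx _ hy).2 (congrArg Subtype.val (Sum.inl_injective h1))
        · rw [hφG k s ⟨x, haN _ _ hx⟩ hx, hφn k t ht] at h1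
          exact (Sum.inl_ne_inr h1).elim
      · by_cases ht : ∃ x, (t • a, x) ∈ G
        · obtain ⟨y, hy⟩ := ht
          rw [hφn k s hs, hφG k t ⟨y, haN _ _ hy⟩ hy] at h1
          exact (Sum.inr_ne_inl h1).elim
        · rw [hφn k s hs, hφn k t ht] at h1
          exact congrArg Prod.snd (Sum.inr_injective h1)
  by_contra hno
  have hbad (k : κ.out) : ∃ s : S, ∃ g : G, g.1.2 = s • p k ∧ ¬ ∃ y, (s • a, y) ∈ G := by
    by_contra hk
    refine hno ⟨p k, hG.sup_cyclic (hpa k) (hpG k) fun s x hx => ?_⟩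
    by_contra hy
    exact hk ⟨s, ⟨_, hx⟩, rfl, hy⟩
  choose s g hg hs using hbad
  -- At a bad point `s k • a` is outside the domain of `G`, so the value of `s k • φ k` at `1`
  -- carries the tag `k`.
  have hinj : Function.Injective g := by
    intro k l hkl
    have h1 : s k • p k = s l • p l := by rw [← hg, ← hg, hkl]
    have h2 := congrFun ((hp _ _ _ _).1 h1) 1
    rw [happ, happ, hφn k _ (hs k), hφn l _ (hs l)] at h2
    exact congrArg Prod.fst (Sum.inr_injective h2)
  have := mk_le_of_injective hinj
  rw [mk_out] at this
  exact absurd hGκ (not_lt.2 this)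

/-- The images of the generating multiples of `a` are finitely many, so they lie in a single `C i`
with `i < α`; closure under the action puts all the other images there too. No assumption on the
cofinality of `α` is needed. -/
theorem IsLimitModel.exists_sup_cyclic [WellFoundedGT (SubMulAction S S)] {κ : Cardinal.{u}}
    (hS : lsNumber S ≤ κ) (hM : IsLimitModel S κ M) {G : SubMulAction S (A × M)}
    (hG : IsPartialIso G) (hGκ : #G < κ) (a : A) : ∃ p, IsPartialIso (G ⊔ cyclic (a, p)) := by
  obtain ⟨α, N, -, hα, -, C, hC, hmono, -, -, huniv, huni⟩ := hM
  let I : SubMulAction S S :=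
    { carrier := {s | ∃ x, (s • a, x) ∈ G}
      smul_mem' := fun r s ⟨x, hx⟩ => ⟨r • x, by
        rw [_root_.smul_eq_mul, mul_smul]
        exact G.smul_mem r hx⟩ }
  obtain ⟨F, hF, hFI⟩ := exists_finset_generators I
  have h1 (t : S) : ∃ i < α, ∀ x, (t • a, x) ∈ G → x ∈ C i := by
    by_cases ht : ∃ x, (t • a, x) ∈ G
    · obtain ⟨x, hx⟩ := ht
      have : x ∈ ⋃ i ∈ Set.Iio α, (C i : Set M) := huniv ▸ Set.mem_univ x
      obtain ⟨i, hi, hxi⟩ := Set.mem_iUnion₂.1 this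
      exact ⟨i, hi, fun y hy => by rwa [show y = x from (hG _ hy _ hx).1 rfl]⟩
    · exact ⟨0, hα.bot_lt, fun x hx => (ht ⟨x, hx⟩).elim⟩
  choose i hi hx using h1
  have hsup : F.sup i < α := (Finset.sup_lt_iff hα.bot_lt).2 fun t _ => hi t
  refine (huni _ hsup).exists_sup_cyclic hS (hC _ hsup) hG hGκ a fun s x hsx => ?_
  obtain ⟨t, ht, r, rfl⟩ := hFI s ⟨x, hsx⟩
  obtain ⟨y, hy⟩ := hF t ht
  have h2 : r • y = x := (hG (r • (t • a, y)) (G.smul_mem r hy) _ hsx).1 (mul_smul r t a).symm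
  rw [← h2]
  exact (C _).smul_mem r (hmono _ _ (Finset.le_sup ht) hsup (hx t y hy))

theorem IsLimitModel.mk_le {κ : Cardinal.{u}} (hM : IsLimitModel S κ M) : #M ≤ κ := by
  obtain ⟨α, N, hκ, hα, hακ, C, hC, hmono, -, -, huniv, huni⟩ := hM
  rw [← mk_univ, huniv]
  exact mk_biUnion_le_of_le (Order.lt_succ_iff.1 (lt_ord.1 hακ)) hκ _ fun i hi => (hC i hi).le

theorem IsLimitModel.exists_bijective [WellFoundedGT (SubMulAction S S)] {κ : Cardinal.{u}}
    (hS : lsNumber S < κ) (hA : IsLimitModel S κ A) (hM : IsLimitModel S κ M) :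
    ∃ f : A →[S] M, Function.Bijective f := by
  have hκ : ℵ₀ ≤ κ := (self_le_add_left _ _).trans hS.le
  obtain ⟨G, hG, hD⟩ := exists_extension_meeting (S := S) (R := A ⊕ M)
    (Good := IsPartialIso) (D := fun r (x : A × M) => Sum.elim (fun a => x.1 = a) (fun m => x.2 = m) r)
    hS (by simpa using add_le_of_le hκ hA.mk_le hM.mk_le)
    (fun ι _ G => IsPartialIso.iSup) (by
      rintro G hG hGκ (a | m)
      · obtain ⟨p, hp⟩ := hM.exists_sup_cyclic hS.le hG hGκ a
        exact ⟨(a, p), rfl, hp⟩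
      · obtain ⟨p, hp⟩ := hA.exists_sup_cyclic hS.le hG.swap (by rwa [mk_swap]) m
        refine ⟨(p, m), rfl, ?_⟩
        rw [← swap_sup_cyclic] at hp
        exact hp.swap)
  have h1 (a : A) : ∃ m, (a, m) ∈ G := by
    obtain ⟨⟨_, m⟩, hx, rfl⟩ := hD (Sum.inl a)
    exact ⟨m, hx⟩
  have h2 (m : M) : ∃ a, (a, m) ∈ G := by
    obtain ⟨⟨a, _⟩, hx, rfl⟩ := hD (Sum.inr m)
    exact ⟨a, hx⟩
  choose f hf using h1
  refine ⟨⟨f, fun s a => (hG _ (hf (s • a)) _ (G.smul_mem s (hf a))).1 rfl⟩, fun a b hab => ?_,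
    fun m => ?_⟩
  · exact (hG _ (hf a) _ (hf b)).2 hab
  · obtain ⟨a, ha⟩ := h2 m
    exact ⟨a, (hG _ (hf a) _ ha).1 rfl⟩

end BackAndForth

theorem superstable_of_wellFoundedGT (S : Type u) [Monoid S] [WellFoundedGT (SubMulAction S S)] :
    Superstable S := by
  -- Existence uses `2 ^ lsNumber S ≤ κ` to count colored functions. Uniqueness needs only `lsNumber
  -- S < κ`, which follows by Cantor's theorem.
  refine ⟨2 ^ lsNumber S, (cantor _).le, fun κ hκ => ⟨?_, fun M M' _ _ hM hM' =>
    hM.exists_bijective ((cantor _).trans_le hκ) hM'⟩⟩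
  refine ⟨Colored S κ.out, inferInstance, ?_⟩
  rw [← mk_out κ] at hκ
  simpa only [mk_out] using isLimitModel_colored hκ

end Act

theorem mainTheorem8 :
    (∀ (S : Type u) [Monoid S], Finite S → Act.Superstable S) ∧
    (∀ (S : Type u) [Group S], Act.Superstable S) ∧
    (∀ (S : Type u) [CommMonoid S], Monoid.FG S → Act.Superstable S) := by
  refine ⟨fun S _ _ => ?_, fun S _ => ?_, fun S _ _ => ?_⟩
  · have := Act.wellFoundedGT_of_finite S
    exact Act.superstable_of_wellFoundedGT S
  · have := Act.wellFoundedGT_of_group S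
    exact Act.superstable_of_wellFoundedGT S
  · have := Act.wellFoundedGT_of_commMonoid_fg S
    exact Act.superstable_of_wellFoundedGT S
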